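/- Let $n \ge 0$ be an integer, let $\mathfrak S_n$ be the symmetric group on $\{1,\dots,n\}$ with elementary transpositions $\sigma_i = (i\ \, i+1)$, $1\le i\le n-1$, and let $\mathbb{C}\mathfrak S_n$ be the complex vector space with basis $\mathfrak S_n$. Operators act on the right of vectors (so that $v\cdot(fg)=(v\cdot f)\cdot g$) and modules are right modules. Let $\sigma_i$ act on $\mathbb{C}\mathfrak S_n$ by $\mu\cdot\sigma_i=\mu\sigma_i$, let $\pi_i$ act by $\mu\cdot\pi_i=\mu$ if $\mu(i)>\mu(i+1)$ and $\mu\cdot\pi_i=\mu\sigma_i$ otherwise, and let $\bar\sigma_i$ act by $\mu\cdot\bar\sigma_i=\sigma_i\mu$. Let $\mathrm{H}\mathfrak S_n$ be the unital subalgebra of $\mathrm{End}(\mathbb{C}\mathfrak S_n)$ generated by $\sigma_1,\dots,\sigma_{n-1},\pi_1,\dots,\pi_{n-1}$. For $\mu\in\mathfrak S_n$ put $\mathrm{Des}(\mu)=\{i : \mu(i)>\mu(i+1)\}$ and $\mathrm{Rec}(\mu)=\mathrm{Des}(\mu^{-1})$; for a composition $I=(k_1,\dots,k_p)$ of $n$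 put $\mathrm{Des}(I)=\{k_1+\dots+k_j : 1\le j<p\}$. For $S\subseteq\{1,\dots,n-1\}$ let $P_S=\bigcap_{i\notin S}\ker(1+\bar\sigma_i)$, which is an $\mathrm{H}\mathfrak S_n$-submodule of $\mathbb{C}\mathfrak S_n$, and let $P_I=P_{\mathrm{Des}(I)}$ for a composition $I$ of $n$. Let $\mathfrak S_S$ be the subgroup of $\mathfrak S_n$ generated by the $\sigma_i$ with $i\notin S$, let $v_S=\sum_{\nu\in\mathfrak S_S}\mathrm{sgn}(\nu)\,\nu$, and for $\sigma\in\mathfrak S_n$ let $v_\sigma=v_{\mathrm{Rec}(\sigma)}\cdot\sigma$. **Theorem.** The family $(v_\sigma)_{\sigma\in\mathfrak S_n}$ is a basis of $\mathbb{C}\mathfrak S_n$. Let $p_\sigma\in\mathrm{End}(\mathbb{C}\mathfrak S_n)$ be the projector on $\mathbb{C}v_\sigma$ parallel to $\bigoplus_{\tau\ne\sigma}\mathbb{C}v_\tau$. Then the following hold. (a) For every $\sigma$, $p_\sigma$ belongs to $\mathrm{H}\mathfrak S_n$ and the right ideal $p_\sigma\mathrm{H}\mathfrak S_n$ is isomorphic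 to $P_{\mathrm{Rec}(\sigma)}$ as an $\mathrm{H}\mathfrak S_n$-module. (b) The $p_\sigma$ give a maximal decomposition of the identity into orthogonal idempotents in $\mathrm{H}\mathfrak S_n$: they are nonzero pairwise orthogonal idempotents of sum $1$, and none of them is a sum of two nonzero orthogonal idempotents of $\mathrm{H}\mathfrak S_n$. (c) The modules $P_I$, where $I$ runs over the compositions of $n$, form a complete set of representatives of the indecomposable projective $\mathrm{H}\mathfrak S_n$-modules: each $P_I$ is projective and indecomposable, $P_I\not\cong P_J$ if $I\ne J$, and every indecomposable projective $\mathrm{H}\mathfrak S_n$-module is isomorphic to some $P_I$. -/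

import Mathlib

namespace HeckeGroup

/-- The plain vector space `ℂ𝔖ₙ` with basis the permutations. A permutation `μ` is a bijection
of `Fin n = {0, …, n-1}`; its word is `μ 0, μ 1, …`, and `μ * ν` is `k ↦ μ (ν k)`. -/
def PermSpace (n : ℕ) : Type := Equiv.Perm (Fin n) →₀ ℂ

noncomputable instance (n : ℕ) : AddCommGroup (PermSpace n) :=
  inferInstanceAs (AddCommGroup (Equiv.Perm (Fin n) →₀ ℂ))

noncomputable instance (n : ℕ) : Module ℂ (PermSpace n) :=
  inferInstanceAs (Module ℂ (Equiv.Perm (Fin n) →₀ ℂ))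

/-- The natural basis of `ℂ𝔖ₙ`: `permBasis n μ` is the permutation `μ` seen as a vector. -/
noncomputable def permBasis (n : ℕ) : Module.Basis (Equiv.Perm (Fin n)) ℂ (PermSpace n) :=
  .ofRepr (LinearEquiv.refl ℂ (Equiv.Perm (Fin n) →₀ ℂ))

/-- The linear operator on `ℂ𝔖ₙ` which extends a map `g` from permutations to permutations. -/
noncomputable def extendOp {n : ℕ} (g : Equiv.Perm (Fin n) → Equiv.Perm (Fin n)) :
    Module.End ℂ (PermSpace n) :=
  (permBasis n).constr ℂ (fun μ => permBasis n (g μ))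

theorem extendOp_apply {n : ℕ} (g : Equiv.Perm (Fin n) → Equiv.Perm (Fin n))
    (μ : Equiv.Perm (Fin n)) : extendOp g (permBasis n μ) = permBasis n (g μ) :=
  (permBasis n).constr_basis ℂ _ μ

/-- The position `i` (the left one of the two adjacent positions exchanged by `sᵢ`).
The index `i : Fin (n - 1)` stands for the element `i + 1` of `{1, …, n-1}`. -/
def lo {n : ℕ} (i : Fin (n - 1)) : Fin n := ⟨i.val, by omega⟩

/-- The position `i + 1`. -/
def hi {n : ℕ} (i : Fin (n - 1)) : Fin n := ⟨i.val + 1, by omega⟩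

/-- The elementary transposition. -/
def simpleTransp {n : ℕ} (i : Fin (n - 1)) : Equiv.Perm (Fin n) := Equiv.swap (lo i) (hi i)

/-- The descent set of a permutation. -/
def permDes {n : ℕ} (μ : Equiv.Perm (Fin n)) : Set (Fin (n - 1)) := {i | μ (hi i) < μ (lo i)}

/-- The recoils of a permutation: the descents of its inverse. -/
def permRec {n : ℕ} (μ : Equiv.Perm (Fin n)) : Set (Fin (n - 1)) := permDes μ⁻¹

/-- The descent set `{k₁ + ⋯ + kⱼ : 1 ≤ j < p}` of a composition `(k₁, …, k_p)` of `n`. -/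
def compDes {n : ℕ} (I : Composition n) : Set (Fin (n - 1)) :=
  {i | ∃ j : ℕ, 1 ≤ j ∧ j < I.length ∧ I.sizeUpTo j = i.val + 1}

/-- The action of `σ` on the right (on positions): `μ ↦ μ σ`. -/
noncomputable def rightMul {n : ℕ} (σ : Equiv.Perm (Fin n)) : Module.End ℂ (PermSpace n) :=
  extendOp (fun μ => μ * σ)

/-- The action of `σ` on the left (on values): `μ ↦ σ μ`. -/
noncomputable def leftMul {n : ℕ} (σ : Equiv.Perm (Fin n)) : Module.End ℂ (PermSpace n) :=
  extendOp (fun μ => σ * μ)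

/-- Decreasing sort of the entries in positions `i` and `i + 1`. -/
def sortPerm {n : ℕ} (i : Fin (n - 1)) (μ : Equiv.Perm (Fin n)) : Equiv.Perm (Fin n) :=
  if μ (hi i) < μ (lo i) then μ else μ * simpleTransp i

/-- The elementary sorting operator `πᵢ`. -/
noncomputable def sortOp {n : ℕ} (i : Fin (n - 1)) : Module.End ℂ (PermSpace n) :=
  extendOp (sortPerm i)

/-- The algebra `H𝔖ₙ`: the (unital) algebra of operators on `ℂ𝔖ₙ` generated by the elementary
transpositions acting on positions and the elementary sorting operators.

Operators of `H𝔖ₙ` are classically written on the right of vectors, so that the product `fg` is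
"first `f`, then `g`". In `Module.End` the product `f * g` is "first `g`, then `f`", so this
subalgebra is the opposite of `H𝔖ₙ` in the former convention: *left* modules over it are
exactly the *right* `H𝔖ₙ`-modules, and its left ideals are the right ideals of `H𝔖ₙ`. -/
noncomputable def HS (n : ℕ) : Subalgebra ℂ (Module.End ℂ (PermSpace n)) :=
  Algebra.adjoin ℂ (Set.range (fun i : Fin (n - 1) => rightMul (simpleTransp i)) ∪
    Set.range (fun i : Fin (n - 1) => sortOp i))

theorem leftMul_rightMul {n : ℕ} (σ τ : Equiv.Perm (Fin n)) (v : PermSpace n) :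
    leftMul σ (rightMul τ v) = rightMul τ (leftMul σ v) := by
  have : leftMul σ ∘ₗ rightMul τ = rightMul τ ∘ₗ leftMul σ := by
    refine (permBasis n).ext fun μ => ?_
    simp only [leftMul, rightMul, LinearMap.comp_apply, extendOp_apply, mul_assoc]
  exact LinearMap.congr_fun this v

/-- Either exchanging the values `i, i + 1` is the same as exchanging the entries in positions
`j, j + 1`, or it does not change the relative order of these entries. -/
theorem transp_cases {n : ℕ} (i j : Fin (n - 1)) (μ : Equiv.Perm (Fin n)) :
    simpleTransp i * μ = μ * simpleTransp j ∨
      ((simpleTransp i * μ) (hi j) < (simpleTransp i * μ) (lo j) ↔ μ (hi j) < μ (lo j)) := by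
  have hne : μ (lo j) ≠ μ (hi j) := by
    intro h
    have := μ.injective h
    simp [lo, hi] at this
  by_cases h1 : μ (lo j) = lo i ∧ μ (hi j) = hi i
  · left
    rw [simpleTransp, simpleTransp, Equiv.mul_swap_eq_swap_mul, h1.1, h1.2]
  by_cases h2 : μ (lo j) = hi i ∧ μ (hi j) = lo i
  · left
    rw [simpleTransp, simpleTransp, Equiv.mul_swap_eq_swap_mul, h2.1, h2.2, Equiv.swap_comm]
  right
  simp only [Equiv.Perm.mul_apply, simpleTransp, Equiv.swap_apply_def]
  generalize μ (lo j) = a at *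
  generalize μ (hi j) = b at *
  simp only [lo, hi, Fin.ext_iff, Fin.lt_def] at *
  split_ifs <;> simp <;> omega

theorem sortPerm_mul {n : ℕ} (i j : Fin (n - 1)) (μ : Equiv.Perm (Fin n)) :
    sortPerm j (simpleTransp i * μ) = sortPerm j μ ∨
      sortPerm j (simpleTransp i * μ) = simpleTransp i * sortPerm j μ := by
  rcases transp_cases i j μ with h | h
  · left
    have hs : simpleTransp j * simpleTransp j = 1 := by simp [simpleTransp]
    have hne : μ (lo j) ≠ μ (hi j) := by
      intro h
      have := μ.injective h
      simp [lo, hi] at this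
    have e1 : (μ * simpleTransp j) (hi j) = μ (lo j) := by simp [simpleTransp]
    have e2 : (μ * simpleTransp j) (lo j) = μ (hi j) := by simp [simpleTransp]
    rw [h]
    unfold sortPerm
    rw [e1, e2, mul_assoc, hs, mul_one]
    rcases lt_or_gt_of_ne hne with h' | h'
    · rw [if_pos h', if_neg h'.not_gt]
    · rw [if_neg h'.not_gt, if_pos h']
  · right
    unfold sortPerm
    by_cases h' : μ (hi j) < μ (lo j)
    · rw [if_pos (h.2 h'), if_pos h']
    · rw [if_neg (fun hh => h' (h.1 hh)), if_neg h', mul_assoc]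

theorem sortOp_antisymm {n : ℕ} (i j : Fin (n - 1)) (v : PermSpace n)
    (hv : leftMul (simpleTransp i) v = -v) :
    leftMul (simpleTransp i) (sortOp j v) = -sortOp j v := by
  set L : Module.End ℂ (PermSpace n) := leftMul (simpleTransp i) with hL
  have key : (1 + L) * sortOp j * (1 - L) = 0 := by
    refine (permBasis n).ext fun μ => ?_
    have hs : ∀ τ : Equiv.Perm (Fin n), simpleTransp i * (simpleTransp i * τ) = τ := by
      intro τ
      rw [← mul_assoc]
      simp [simpleTransp]
    simp only [hL, leftMul, sortOp, Module.End.mul_apply, LinearMap.add_apply,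
      LinearMap.sub_apply, Module.End.one_apply, map_sub, extendOp_apply, LinearMap.zero_apply]
    rcases sortPerm_mul i j μ with h | h
    · rw [h]; abel
    · rw [h, hs]; abel
  have h := LinearMap.congr_fun key ((1 / 2 : ℂ) • v)
  have e : (1 - L) ((1 / 2 : ℂ) • v) = v := by
    rw [LinearMap.sub_apply, Module.End.one_apply, map_smul, hv, smul_neg, sub_neg_eq_add,
      ← add_smul]
    norm_num
  rw [Module.End.mul_apply, e, Module.End.mul_apply, LinearMap.add_apply,
    Module.End.one_apply, LinearMap.zero_apply] at h
  exact (neg_eq_of_add_eq_zero_right h).symm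

/-- Every operator of `H𝔖ₙ` preserves left antisymmetries. -/
theorem HS_antisymm {n : ℕ} (i : Fin (n - 1)) {f : Module.End ℂ (PermSpace n)} (hf : f ∈ HS n) :
    ∀ v : PermSpace n, leftMul (simpleTransp i) v = -v →
      leftMul (simpleTransp i) (f v) = -f v := by
  unfold HS at hf
  induction hf using Algebra.adjoin_induction with
  | mem f hf =>
    intro v hv
    rcases hf with ⟨j, rfl⟩ | ⟨j, rfl⟩
    · rw [leftMul_rightMul, hv, map_neg]
    · exact sortOp_antisymm i j v hv
  | algebraMap c =>
    intro v hv
    rw [Module.algebraMap_end_apply, map_smul, hv, smul_neg]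
  | add f g _ _ hf hg =>
    intro v hv
    rw [LinearMap.add_apply, map_add, hf v hv, hg v hv, neg_add]
  | mul f g _ _ hf hg =>
    intro v hv
    exact hf _ (hg v hv)

/-- For a subset `S`, the `H𝔖ₙ`-submodule `⋂_{i ∉ S} ker (1 + σ̄ᵢ)` of `ℂ𝔖ₙ`, where `σ̄ᵢ` is the
left multiplication by the `i`-th elementary transposition: the vectors which are left
`i`-antisymmetric for every `i ∉ S`. -/
noncomputable def antisymModule {n : ℕ} (S : Set (Fin (n - 1))) :
    Submodule (HS n) (PermSpace n) where
  carrier := {v | ∀ i ∉ S, v ∈ LinearMap.ker (1 + leftMul (simpleTransp i))}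
  zero_mem' := fun i _ => Submodule.zero_mem _
  add_mem' := fun hv hw i hi => Submodule.add_mem _ (hv i hi) (hw i hi)
  smul_mem' := by
    intro f v hv i hi
    have h : ∀ w : PermSpace n, w ∈ LinearMap.ker (1 + leftMul (simpleTransp i)) ↔
        leftMul (simpleTransp i) w = -w := by
      intro w
      rw [LinearMap.mem_ker, LinearMap.add_apply, Module.End.one_apply, add_comm]
      exact add_eq_zero_iff_eq_neg
    exact (h _).2 (HS_antisymm i f.2 v ((h v).1 (hv i hi)))

/-- The module `P_I` attached to a composition `I` of `n`. -/
noncomputable abbrev P {n : ℕ} (I : Composition n) : Submodule (HS n) (PermSpace n) :=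
  antisymModule (compDes I)

/-- The standard Young subgroup attached to `S`, generated by the elementary transpositions
with index not in `S`. -/
def young {n : ℕ} (S : Set (Fin (n - 1))) : Subgroup (Equiv.Perm (Fin n)) :=
  Subgroup.closure (simpleTransp '' Sᶜ)

open Classical in
/-- The alternating sum `∑ (-1)^{ℓ(ν)} ν` over the Young subgroup attached to `S`. -/
noncomputable def vSet {n : ℕ} (S : Set (Fin (n - 1))) : PermSpace n :=
  ∑ ν : Equiv.Perm (Fin n) with ν ∈ young S,
    (((Equiv.Perm.sign ν : ℤˣ) : ℤ) : ℂ) • permBasis n ν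

/-- The vector `v_σ = v_{Rec(σ)} σ`. -/
noncomputable def vPerm {n : ℕ} (σ : Equiv.Perm (Fin n)) : PermSpace n :=
  rightMul σ (vSet (permRec σ))

/-- For a basis `b`, the projector on the line spanned by `b i` parallel to the span of the
other basis vectors. -/
noncomputable def lineProjector {ι V : Type*} [AddCommGroup V] [Module ℂ V]
    (b : Module.Basis ι ℂ V) (i : ι) : Module.End ℂ V :=
  (b.coord i).smulRight (b i)

/-- A maximal decomposition of the identity into orthogonal idempotents: nonzero pairwise
orthogonal idempotents of sum `1`, none of which can be split further as a sum of two nonzero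
orthogonal idempotents of the ring. -/
structure IsMaximalDecomposition {R ι : Type*} [Ring R] [Fintype ι] (e : ι → R) : Prop where
  complete : CompleteOrthogonalIdempotents e
  ne_zero : ∀ i, e i ≠ 0
  maximal : ∀ i, ∀ a b : R, IsIdempotentElem a → IsIdempotentElem b → a * b = 0 → b * a = 0 →
    e i = a + b → a = 0 ∨ b = 0

/-- A module is indecomposable if it is nonzero and is not the internal direct sum of two nonzero
submodules. -/
def IsIndecomposable (R M : Type*) [Ring R] [AddCommGroup M] [Module R M] : Prop :=
  Nontrivial M ∧ ∀ A B : Submodule R M, IsCompl A B → A = ⊥ ∨ B = ⊥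

end HeckeGroup

namespace HeckeGroup

open Finset

/-! The key fact is that `HS n` contains many rank one operators. The operator `y ↦ φ(y) x` belongs
to it as soon as `x` is left antisymmetric for every `i ∉ S` and `φ` is invariant under left
multiplication by `simpleTransp i` for every `i ∈ S` (`smulRight_mem`). Such operators are assembled
from one operator that sends the Young subgroup of `Sᶜ` to a nonzero multiple of `vSet S` and kills
all other permutations (`exists_indicator_op`); it is built by sorting.

On the other side, `vPerm σ` is `σ` plus terms of smaller energy, and the leading terms of a vector
of `antisymModule S` have their recoils in `S`. Hence the `vPerm σ` form a basis adapted to all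
these modules at once: `antisymModule S` is spanned by those with `permRec σ ⊆ S`
(`mem_antisymModule_iff`). Adaptedness gives the dual coordinate forms the invariance required
above, so the projectors lie in `HS n`.

Since `vPerm σ` generates `antisymModule (permRec σ)`, evaluation at it identifies the ideal of the
projector with this module. Indecomposability and the absence of isomorphisms are read off the
coordinates. A given indecomposable projective module is mapped onto some `antisymModule S`, and the
map splits. -/

theorem lo_lt_hi {n : ℕ} (i : Fin (n - 1)) : lo i < hi i := by
  simp [lo, hi, Fin.lt_def]

theorem lo_ne_hi {n : ℕ} (i : Fin (n - 1)) : lo i ≠ hi i := (lo_lt_hi i).ne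

theorem simpleTransp_mul_self {n : ℕ} (i : Fin (n - 1)) :
    simpleTransp i * simpleTransp i = 1 := by simp [simpleTransp]

theorem simpleTransp_inv {n : ℕ} (i : Fin (n - 1)) :
    (simpleTransp i)⁻¹ = simpleTransp i := by simp [simpleTransp]

@[simp] theorem simpleTransp_lo {n : ℕ} (i : Fin (n - 1)) : simpleTransp i (lo i) = hi i := by
  simp [simpleTransp]

@[simp] theorem simpleTransp_hi {n : ℕ} (i : Fin (n - 1)) : simpleTransp i (hi i) = lo i := by
  simp [simpleTransp]

theorem sign_simpleTransp {n : ℕ} (i : Fin (n - 1)) :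
    Equiv.Perm.sign (simpleTransp i) = -1 := Equiv.Perm.sign_swap (lo_ne_hi i)

theorem not_mem_permDes {n : ℕ} {μ : Equiv.Perm (Fin n)} {i : Fin (n - 1)} :
    i ∉ permDes μ ↔ μ (lo i) < μ (hi i) := by
  have : μ (lo i) ≠ μ (hi i) := fun h => lo_ne_hi i (μ.injective h)
  simp only [permDes, Set.mem_ofPred_eq, not_lt]
  exact ⟨fun h => lt_of_le_of_ne h this, le_of_lt⟩

theorem mem_permDes {n : ℕ} {μ : Equiv.Perm (Fin n)} {i : Fin (n - 1)} :
    i ∈ permDes μ ↔ μ (hi i) < μ (lo i) := Iff.rfl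

theorem mem_permDes_mul_simpleTransp {n : ℕ} {μ : Equiv.Perm (Fin n)} {i : Fin (n - 1)} :
    i ∈ permDes (μ * simpleTransp i) ↔ i ∉ permDes μ := by
  rw [not_mem_permDes, mem_permDes]
  simp

/-! ### Energy, a substitute for the Coxeter length that reverses its order -/

/-- The sum `∑ k μ(k)`, which decreases whenever an ascent is exchanged. -/
def energy {n : ℕ} (μ : Equiv.Perm (Fin n)) : ℕ := ∑ k : Fin n, k.val * (μ k).val

theorem energy_inv {n : ℕ} (μ : Equiv.Perm (Fin n)) : energy μ⁻¹ = energy μ := by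
  unfold energy
  rw [← Equiv.sum_comp μ]
  simp [mul_comm]

/-- An instance of the rearrangement inequality: the loss is exactly `μ (hi i) - μ (lo i)`. -/
theorem energy_mul_simpleTransp_lt {n : ℕ} {μ : Equiv.Perm (Fin n)} {i : Fin (n - 1)}
    (h : i ∉ permDes μ) : energy (μ * simpleTransp i) < energy μ := by
  rw [not_mem_permDes, Fin.lt_def] at h
  have e : energy (μ * simpleTransp i) = ∑ k : Fin n, (simpleTransp i k).val * (μ k).val := by
    unfold energy
    rw [← Equiv.sum_comp (simpleTransp i)]
    refine sum_congr rfl fun k _ => ?_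
    rw [Equiv.Perm.mul_apply, ← Equiv.Perm.mul_apply (simpleTransp i), simpleTransp_mul_self,
      Equiv.Perm.one_apply]
  have d : (energy μ : ℤ) - energy (μ * simpleTransp i) = (μ (hi i)).val - (μ (lo i)).val := by
    rw [e, energy]
    push_cast
    rw [← sum_sub_distrib, Fintype.sum_eq_add (lo i) (hi i) (lo_ne_hi i)]
    · rw [simpleTransp_lo, simpleTransp_hi]
      have : ((hi i).val : ℤ) = (lo i).val + 1 := by simp [lo, hi]
      rw [this]
      ring
    · rintro x ⟨h1, h2⟩
      rw [simpleTransp, Equiv.swap_apply_of_ne_of_ne h1 h2, sub_self]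
  omega

theorem energy_lt_mul_simpleTransp {n : ℕ} {μ : Equiv.Perm (Fin n)} {i : Fin (n - 1)}
    (h : i ∈ permDes μ) : energy μ < energy (μ * simpleTransp i) := by
  have := energy_mul_simpleTransp_lt (μ := μ * simpleTransp i) (i := i)
    (by rw [mem_permDes_mul_simpleTransp]; exact not_not.2 h)
  rwa [mul_assoc, simpleTransp_mul_self, mul_one] at this

theorem energy_lt_simpleTransp_mul {n : ℕ} {μ : Equiv.Perm (Fin n)} {i : Fin (n - 1)}
    (h : i ∈ permRec μ) : energy μ < energy (simpleTransp i * μ) := by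
  have := energy_lt_mul_simpleTransp h
  rwa [← simpleTransp_inv, ← mul_inv_rev, energy_inv, energy_inv] at this

/-! ### Young subgroups and their cosets -/

theorem simpleTransp_mem_young {n : ℕ} {S : Set (Fin (n - 1))} {i : Fin (n - 1)} (h : i ∉ S) :
    simpleTransp i ∈ young S := Subgroup.subset_closure ⟨i, h, rfl⟩

theorem simpleTransp_le_iff {n : ℕ} {i j : Fin (n - 1)} (h : i ≠ j) (k : Fin n) :
    (simpleTransp j k).val ≤ i.val ↔ k.val ≤ i.val := by
  simp only [simpleTransp, Equiv.swap_apply_def]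
  have := Fin.val_ne_of_ne h
  split_ifs with h1 h2
  · subst h1; simp only [lo, hi]; omega
  · subst h2; simp only [lo, hi]; omega
  · rfl

/-- For `i ∈ S` no generator crosses the cut between positions `i` and `i + 1`, so the group
preserves the initial segment ending at `i`. -/
theorem young_le_iff {n : ℕ} {S : Set (Fin (n - 1))} {w : Equiv.Perm (Fin n)}
    (hw : w ∈ young S) {i : Fin (n - 1)} (hi : i ∈ S) (k : Fin n) :
    (w k).val ≤ i.val ↔ k.val ≤ i.val := by
  unfold young at hw
  induction hw using Subgroup.closure_induction generalizing k with
  | mem x hx =>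
    obtain ⟨j, hj, rfl⟩ := hx
    exact simpleTransp_le_iff (fun h => hj (by rwa [← h])) k
  | one => rfl
  | mul x y _ _ hx hy => rw [Equiv.Perm.mul_apply, hx, hy]
  | inv x _ hx => rw [← hx, ← Equiv.Perm.mul_apply, mul_inv_cancel, Equiv.Perm.one_apply]

theorem permDes_subset_of_mem_young {n : ℕ} {S : Set (Fin (n - 1))} {w : Equiv.Perm (Fin n)}
    (hw : w ∈ young S) : permDes w ⊆ Sᶜ := by
  intro i h hi'
  have h1 := (young_le_iff hw hi' (lo i)).2 (le_refl _)
  have h2 := (young_le_iff hw hi' (hi i)).not.2 (by simp [hi])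
  rw [mem_permDes, Fin.lt_def] at h
  omega

theorem lt_of_ascents {n : ℕ} {μ : Equiv.Perm (Fin n)} {a b : Fin n} (hab : a < b)
    (h : ∀ j : Fin (n - 1), a.val ≤ j.val → j.val < b.val → j ∉ permDes μ) : μ a < μ b := by
  obtain ⟨a, ha⟩ := a
  obtain ⟨b, hb⟩ := b
  simp only [Fin.mk_lt_mk] at hab h
  induction b, hab using Nat.le_induction with
  | base => exact not_mem_permDes.1 (h ⟨a, by omega⟩ le_rfl (Nat.lt_succ_self a))
  | succ b hab ih =>
    refine (ih (by omega) fun j h1 h2 => h j h1 (by omega)).trans ?_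
    exact not_mem_permDes.1 (h ⟨b, by omega⟩ (by simp; omega) (by simp))

theorem eq_one_of_permDes_eq_empty {n : ℕ} {w : Equiv.Perm (Fin n)} (h : permDes w = ∅) :
    w = 1 := by
  have hm : StrictMono w := fun a b hab => lt_of_ascents hab fun j _ _ => by simp [h]
  have := (hm.range_inj strictMono_id).1 (by simp)
  ext k
  simp [this]

/-- Each coset of a Young subgroup has at most one element without inner descents. -/
theorem eq_one_of_mem_young {n : ℕ} {S : Set (Fin (n - 1))} {μ w : Equiv.Perm (Fin n)}
    (hw : w ∈ young S) (h1 : permDes μ ⊆ S) (h2 : permDes (μ * w) ⊆ S) : w = 1 := by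
  refine eq_one_of_permDes_eq_empty (Set.eq_empty_of_forall_notMem fun i hi' => ?_)
  have hiS : i ∉ S := permDes_subset_of_mem_young hw hi'
  have a2 := not_mem_permDes.1 fun h => hiS (h2 h)
  -- The values `w (hi i) < w (lo i)` lie in one block of `S`: a cut `j ∈ S` between them would be
  -- preserved by `w` and would separate `hi i` from `lo i` in the wrong order. As `μ` increases on
  -- blocks, this contradicts the ascent of `μ * w` at `i`.
  refine lt_asymm a2 (lt_of_ascents (μ := μ) (mem_permDes.1 hi') fun j hj1 hj2 hj => ?_)
  have hjS := h1 hj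
  have b1 := (young_le_iff hw hjS (hi i)).1 hj1
  have b2 := (young_le_iff hw hjS (lo i)).not.1 (not_le.2 hj2)
  simp only [lo, hi] at b1 b2
  omega

/-- A permutation with all its recoils in `S` has the greatest energy in its left coset modulo
the Young subgroup of `S`. -/
theorem energy_mul_lt {n : ℕ} {S : Set (Fin (n - 1))} {σ ν : Equiv.Perm (Fin n)}
    (hν : ν ∈ young S) (hne : ν ≠ 1) (hσ : permRec σ ⊆ S) : energy (ν * σ) < energy σ := by
  classical
  -- At a maximizer there is no recoil outside `S`, since a further left multiplication would raise
  -- the energy within the coset. Uniqueness of such an element, applied to inverses, forces `τ =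
  -- 1`.
  have key : ∀ τ ∈ young S, (∀ ρ ∈ young S, energy (ρ * σ) ≤ energy (τ * σ)) → τ = 1 := by
    intro τ hτ hmax
    have h2 : permRec (τ * σ) ⊆ S := by
      intro i hi'
      by_contra hiS
      have := hmax _ (mul_mem (simpleTransp_mem_young hiS) hτ)
      rw [mul_assoc] at this
      exact absurd this (not_le.2 (energy_lt_simpleTransp_mul hi'))
    rw [permRec, mul_inv_rev] at h2
    exact inv_eq_one.1 (eq_one_of_mem_young (inv_mem hτ) hσ h2)
  obtain ⟨τ, hτ, hmax⟩ := exists_max_image ({ρ | ρ ∈ young S} : Finset (Equiv.Perm (Fin n)))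
    (fun ρ => energy (ρ * σ)) ⟨1, by simp [one_mem]⟩
  simp only [mem_filter, mem_univ, true_and] at hτ hmax
  have h1 := key τ hτ hmax
  rw [h1, one_mul] at hmax
  refine lt_of_le_of_ne (hmax ν hν) fun h => hne (key ν hν fun ρ hρ => ?_)
  rw [h]
  exact hmax ρ hρ

/-- The longest element of the Young subgroup of `Sᶜ`, found as an energy minimizer, has descent set
exactly `S`; its inverse is the witness. -/
theorem exists_permRec_eq {n : ℕ} (S : Set (Fin (n - 1))) :
    ∃ σ : Equiv.Perm (Fin n), permRec σ = S := by
  classical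
  obtain ⟨τ, hτ, hmin⟩ := exists_min_image ({ρ | ρ ∈ young Sᶜ} : Finset (Equiv.Perm (Fin n)))
    energy ⟨1, by simp [one_mem]⟩
  simp only [mem_filter, mem_univ, true_and] at hτ hmin
  refine ⟨τ⁻¹, ?_⟩
  rw [permRec, inv_inv]
  refine Set.Subset.antisymm (by simpa using permDes_subset_of_mem_young hτ) fun i hi' => ?_
  by_contra h
  have := hmin _ (mul_mem hτ (simpleTransp_mem_young (i := i) (by simpa using hi')))
  exact absurd this (not_le.2 (energy_mul_simpleTransp_lt h))

/-! ### Multiplication operators and antisymmetrizers -/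

theorem rightMul_apply {n : ℕ} (σ μ : Equiv.Perm (Fin n)) :
    rightMul σ (permBasis n μ) = permBasis n (μ * σ) := extendOp_apply _ _

theorem leftMul_apply {n : ℕ} (σ μ : Equiv.Perm (Fin n)) :
    leftMul σ (permBasis n μ) = permBasis n (σ * μ) := extendOp_apply _ _

theorem leftMul_mul {n : ℕ} (σ τ : Equiv.Perm (Fin n)) (x : PermSpace n) :
    leftMul (σ * τ) x = leftMul σ (leftMul τ x) := by
  have : leftMul (σ * τ) = leftMul σ ∘ₗ leftMul τ :=
    (permBasis n).ext fun μ => by simp [leftMul_apply, mul_assoc]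
  exact LinearMap.congr_fun this x

theorem rightMul_mul {n : ℕ} (σ τ : Equiv.Perm (Fin n)) :
    rightMul (σ * τ) = rightMul τ * rightMul σ :=
  (permBasis n).ext fun μ => by simp [rightMul_apply, mul_assoc]

theorem leftMul_one {n : ℕ} : (leftMul 1 : Module.End ℂ (PermSpace n)) = 1 :=
  (permBasis n).ext fun μ => by simp [leftMul_apply]

theorem rightMul_one {n : ℕ} : (rightMul 1 : Module.End ℂ (PermSpace n)) = 1 :=
  (permBasis n).ext fun μ => by simp [rightMul_apply]

theorem rightMul_simpleTransp_mem {n : ℕ} (i : Fin (n - 1)) :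
    rightMul (simpleTransp i) ∈ HS n :=
  Algebra.subset_adjoin (Or.inl ⟨i, rfl⟩)

theorem sortOp_mem {n : ℕ} (i : Fin (n - 1)) : sortOp i ∈ HS n :=
  Algebra.subset_adjoin (Or.inr ⟨i, rfl⟩)

/-- A counterexample of greatest energy has no descent, because removing one would give another
counterexample of greater energy; so it is the identity. -/
theorem rightMul_mem {n : ℕ} (σ : Equiv.Perm (Fin n)) : rightMul σ ∈ HS n := by
  classical
  by_contra hσ
  obtain ⟨τ, hτ, hmax⟩ := exists_max_image
    ({ρ | rightMul ρ ∉ HS n} : Finset (Equiv.Perm (Fin n))) energy ⟨σ, by simpa using hσ⟩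
  simp only [mem_filter, mem_univ, true_and] at hτ hmax
  have h0 : permDes τ = ∅ := by
    refine Set.eq_empty_of_forall_notMem fun i hi' => ?_
    refine absurd (hmax (τ * simpleTransp i) fun h => hτ ?_)
      (not_le.2 (energy_lt_mul_simpleTransp hi'))
    have := mul_mem (rightMul_simpleTransp_mem i) h
    rwa [← rightMul_mul, mul_assoc, simpleTransp_mul_self, mul_one] at this
  rw [eq_one_of_permDes_eq_empty h0, rightMul_one] at hτ
  exact hτ (one_mem _)

/-- The signature as a complex number. -/
def signC {n : ℕ} (ν : Equiv.Perm (Fin n)) : ℂ := (((Equiv.Perm.sign ν : ℤˣ) : ℤ) : ℂ)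

theorem signC_mul {n : ℕ} (μ ν : Equiv.Perm (Fin n)) : signC (μ * ν) = signC μ * signC ν := by
  simp [signC]

theorem signC_one {n : ℕ} : signC (1 : Equiv.Perm (Fin n)) = 1 := by simp [signC]

theorem signC_simpleTransp {n : ℕ} (i : Fin (n - 1)) : signC (simpleTransp i) = -1 := by
  simp [signC, sign_simpleTransp]

theorem signC_mul_self {n : ℕ} (ν : Equiv.Perm (Fin n)) : signC ν * signC ν = 1 := by
  rw [signC, ← Int.cast_mul, ← Units.val_mul, Int.units_mul_self]; simp

open Classical in
theorem vSet_eq {n : ℕ} (S : Set (Fin (n - 1))) :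
    vSet S = ∑ ν, if ν ∈ young S then signC ν • permBasis n ν else 0 := by
  rw [vSet, sum_filter]; rfl

theorem leftMul_vSet {n : ℕ} {S : Set (Fin (n - 1))} {i : Fin (n - 1)} (h : i ∉ S) :
    leftMul (simpleTransp i) (vSet S) = -vSet S := by
  classical
  rw [vSet_eq, map_sum, ← sum_neg_distrib, ← Equiv.sum_comp (Equiv.mulLeft (simpleTransp i))]
  refine sum_congr rfl fun ν _ => ?_
  rw [Equiv.coe_mulLeft, Subgroup.mul_mem_cancel_left _ (simpleTransp_mem_young h)]
  split_ifs
  · rw [map_smul, leftMul_apply, ← mul_assoc, simpleTransp_mul_self, one_mul, signC_mul,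
      signC_simpleTransp, neg_one_mul, neg_smul]
  · simp

open Classical in
/-- Right multiplication by the alternating sum over a Young subgroup. -/
noncomputable def altOp {n : ℕ} (S : Set (Fin (n - 1))) : Module.End ℂ (PermSpace n) :=
  ∑ ν, if ν ∈ young S then signC ν • rightMul ν else 0

theorem altOp_mem {n : ℕ} (S : Set (Fin (n - 1))) : altOp S ∈ HS n := by
  classical
  refine sum_mem fun ν _ => ?_
  split_ifs
  · exact (HS n).smul_mem (rightMul_mem ν) _
  · exact zero_mem _

theorem altOp_one {n : ℕ} (S : Set (Fin (n - 1))) : altOp S (permBasis n 1) = vSet S := by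
  classical
  rw [altOp, vSet_eq, LinearMap.sum_apply]
  refine sum_congr rfl fun ν _ => ?_
  split_ifs
  · rw [LinearMap.smul_apply, rightMul_apply, one_mul]
  · rfl

theorem altOp_mul_simpleTransp {n : ℕ} {S : Set (Fin (n - 1))} {i : Fin (n - 1)} (h : i ∉ S)
    (μ : Equiv.Perm (Fin n)) :
    altOp S (permBasis n (μ * simpleTransp i)) = -altOp S (permBasis n μ) := by
  classical
  rw [altOp, LinearMap.sum_apply, LinearMap.sum_apply, ← sum_neg_distrib,
    ← Equiv.sum_comp (Equiv.mulLeft (simpleTransp i))]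
  refine sum_congr rfl fun ν _ => ?_
  rw [Equiv.coe_mulLeft, Subgroup.mul_mem_cancel_left _ (simpleTransp_mem_young h)]
  split_ifs
  · rw [LinearMap.smul_apply, LinearMap.smul_apply, rightMul_apply, rightMul_apply, mul_assoc,
      ← mul_assoc (simpleTransp i), simpleTransp_mul_self, one_mul, signC_mul,
      signC_simpleTransp, neg_one_mul, neg_smul]
  · simp

/-! ### Sorting maps and the indicator operator of a Young subgroup -/

/-- The maps obtained by composing increasing sorts of adjacent positions `i, i + 1`, `i ∉ S`. -/
inductive IsSorting {n : ℕ} (S : Set (Fin (n - 1))) :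
    (Equiv.Perm (Fin n) → Equiv.Perm (Fin n)) → Prop
  | id : IsSorting S id
  | step {s} {i : Fin (n - 1)} (hi : i ∉ S) (hs : IsSorting S s) :
      IsSorting S (fun ν => sortPerm i (s ν) * simpleTransp i)

theorem IsSorting.extendOp_mem {n : ℕ} {S : Set (Fin (n - 1))}
    {s : Equiv.Perm (Fin n) → Equiv.Perm (Fin n)} (hs : IsSorting S s) :
    extendOp s ∈ HS n := by
  induction hs with
  | id =>
    convert one_mem (HS n)
    exact (permBasis n).ext fun μ => by simp [extendOp_apply]
  | @step s i _ _ ih =>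
    convert mul_mem (mul_mem (rightMul_simpleTransp_mem i) (sortOp_mem i)) ih
    exact (permBasis n).ext fun μ => by simp [extendOp_apply, sortOp, rightMul_apply]

theorem IsSorting.inv_mul_mem {n : ℕ} {S : Set (Fin (n - 1))}
    {s : Equiv.Perm (Fin n) → Equiv.Perm (Fin n)} (hs : IsSorting S s)
    (ν : Equiv.Perm (Fin n)) : ν⁻¹ * s ν ∈ young S := by
  induction hs with
  | id => simp [one_mem]
  | @step s i hi _ ih =>
    simp only [sortPerm]
    split_ifs
    · rw [← mul_assoc]
      exact mul_mem ih (simpleTransp_mem_young hi)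
    · rwa [mul_assoc (s ν), simpleTransp_mul_self, mul_one]

/-- An operator which weights an antisymmetrizer by the fibres of a sorting map. -/
theorem IsSorting.exists_fiber_op {n : ℕ} {S : Set (Fin (n - 1))}
    {s : Equiv.Perm (Fin n) → Equiv.Perm (Fin n)} (hs : IsSorting S s) :
    ∃ D ∈ HS n, ∀ μ, D (permBasis n μ) =
      (∑ ν, if s ν = μ then (1 : ℂ) else 0) • altOp S (permBasis n μ) := by
  induction hs with
  | id => exact ⟨altOp S, altOp_mem S, fun μ => by simp⟩
  | @step s i hi _ ih =>
    obtain ⟨D, hD, h⟩ := ih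
    -- If `μ` has a descent at `i`, then `1 - sortOp i` kills it, and its fibre under the extended
    -- sorting is empty. If `μ` has an ascent, the fibres over `μ` and `μ * simpleTransp i` merge,
    -- and antisymmetry of `altOp S` turns the difference into the sum of their sizes.
    refine ⟨D * (1 - sortOp i), mul_mem hD (sub_mem (one_mem _) (sortOp_mem i)), fun μ => ?_⟩
    rw [Module.End.mul_apply, LinearMap.sub_apply, Module.End.one_apply, sortOp, extendOp_apply,
      map_sub]
    have hd : ∀ τ : Equiv.Perm (Fin n), i ∉ permDes (sortPerm i τ * simpleTransp i) := by
      intro τ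
      rw [mem_permDes_mul_simpleTransp, not_not, sortPerm]
      split_ifs with h'
      · exact h'
      · exact mem_permDes_mul_simpleTransp.2 h'
    by_cases hμ : i ∈ permDes μ
    · rw [show sortPerm i μ = μ from if_pos hμ, sub_self, sum_eq_zero, zero_smul]
      intro ν _
      rw [if_neg]
      intro e
      beta_reduce at e
      exact hd (s ν) (by rwa [e])
    · rw [show sortPerm i μ = μ * simpleTransp i from if_neg hμ, h, h,
        altOp_mul_simpleTransp hi, smul_neg, sub_neg_eq_add, ← add_smul, ← sum_add_distrib]
      congr 1
      refine sum_congr rfl fun ν _ => ?_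
      beta_reduce
      generalize s ν = τ
      by_cases hτ : i ∈ permDes τ
      · have e1 : τ ≠ μ := fun e => hμ (e ▸ hτ)
        have e2 : τ * simpleTransp i = μ ↔ τ = μ * simpleTransp i := by
          rw [← eq_mul_inv_iff_mul_eq, simpleTransp_inv]
        rw [show sortPerm i τ = τ from if_pos hτ, if_neg e1, zero_add]
        simp only [e2]
      · have e1 : τ ≠ μ * simpleTransp i := fun e =>
          hτ (e ▸ mem_permDes_mul_simpleTransp.2 hμ)
        rw [show sortPerm i τ = τ * simpleTransp i from if_neg hτ, if_neg e1, add_zero,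
          mul_assoc, simpleTransp_mul_self, mul_one]

/-- There are finitely many sorting maps. One of greatest total energy leaves no descent outside
`S`, since a further sort never lowers an energy and raises it wherever there is such a descent. -/
theorem exists_isSorting {n : ℕ} (S : Set (Fin (n - 1))) :
    ∃ s : Equiv.Perm (Fin n) → Equiv.Perm (Fin n), IsSorting S s ∧ ∀ ν, permDes (s ν) ⊆ S := by
  classical
  obtain ⟨s, hs, hmax⟩ := exists_max_image
    ({s | IsSorting S s} : Finset (Equiv.Perm (Fin n) → Equiv.Perm (Fin n)))
    (fun s => ∑ ν, energy (s ν)) ⟨id, by simpa using IsSorting.id⟩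
  simp only [mem_filter, mem_univ, true_and] at hs hmax
  refine ⟨s, hs, fun ν i hi' => ?_⟩
  by_contra hiS
  refine absurd (hmax _ (hs.step hiS)) (not_le.2 (sum_lt_sum (fun τ _ => ?_) ⟨ν, mem_univ _, ?_⟩))
  · by_cases hτ : i ∈ permDes (s τ)
    · rw [show sortPerm i (s τ) = s τ from if_pos hτ]
      exact (energy_lt_mul_simpleTransp hτ).le
    · rw [show sortPerm i (s τ) = s τ * simpleTransp i from if_neg hτ, mul_assoc,
        simpleTransp_mul_self, mul_one]
  · rw [show sortPerm i (s ν) = s ν from if_pos hi']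
    exact energy_lt_mul_simpleTransp hi'

open Classical in
theorem exists_indicator_op {n : ℕ} (S : Set (Fin (n - 1))) :
    ∃ T ∈ HS n, ∃ c : ℂ, c ≠ 0 ∧ ∀ μ, T (permBasis n μ) =
      if μ ∈ young Sᶜ then c • vSet S else 0 := by
  obtain ⟨s, hs, hsS⟩ := exists_isSorting S
  obtain ⟨t, ht, htS⟩ := exists_isSorting Sᶜ
  obtain ⟨D, hD, hDs⟩ := hs.exists_fiber_op
  have one : ∀ {S : Set (Fin (n - 1))} {w : Equiv.Perm (Fin n)}, w ∈ young S →
      permDes w ⊆ S → w = 1 := fun {S w} hw h =>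
    eq_one_of_mem_young (μ := 1) hw (by
      intro i hi'
      rw [mem_permDes] at hi'
      exact absurd hi' (lo_lt_hi i).not_gt) (by rwa [one_mul])
  -- First `t` sorts inside the cosets of the Young subgroup of `Sᶜ`, leaving descents in `Sᶜ` only;
  -- `D` then kills whatever is not a value of `s`, and values of `s` have descents in `S` only.
  -- What survives both is the identity, and the constant is the size of its fibre under `s`.
  refine ⟨D * extendOp t, mul_mem hD ht.extendOp_mem, ∑ ν, if s ν = 1 then (1 : ℂ) else 0,
    ?_, fun μ => ?_⟩
  · have h1 : s 1 = 1 := one (by simpa using hs.inv_mul_mem 1) (hsS 1)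
    rw [← sum_filter, sum_const, nsmul_one, Nat.cast_ne_zero, Finset.card_ne_zero]
    exact ⟨1, by simpa using h1⟩
  · rw [Module.End.mul_apply, extendOp_apply, hDs]
    split_ifs with hμ
    · have : t μ = 1 := one (by
        have := mul_mem hμ (ht.inv_mul_mem μ)
        rwa [mul_inv_cancel_left] at this) (htS μ)
      rw [this, altOp_one]
    · rw [sum_eq_zero, zero_smul]
      intro ν _
      refine if_neg fun e => hμ ?_
      have h0 : permDes (t μ) = ∅ := by
        rw [← Set.subset_empty_iff, ← Set.inter_compl_self S]
        exact Set.subset_inter (e ▸ hsS ν) (htS μ)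
      have := ht.inv_mul_mem μ
      rw [eq_one_of_permDes_eq_empty h0, mul_one] at this
      exact inv_mem_iff.1 this

/-! ### Generation of `antisymModule S` by one vector, and rank one operators -/

theorem mem_antisymModule {n : ℕ} {S : Set (Fin (n - 1))} {x : PermSpace n} :
    x ∈ antisymModule S ↔ ∀ i ∉ S, leftMul (simpleTransp i) x = -x := by
  refine forall₂_congr fun i _ => ?_
  rw [LinearMap.mem_ker, LinearMap.add_apply, Module.End.one_apply, add_comm]
  exact add_eq_zero_iff_eq_neg

theorem leftMul_young {n : ℕ} {S : Set (Fin (n - 1))} {x : PermSpace n}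
    (hx : x ∈ antisymModule S) {ν : Equiv.Perm (Fin n)} (hν : ν ∈ young S) :
    leftMul ν x = signC ν • x := by
  rw [mem_antisymModule] at hx
  unfold young at hν
  induction hν using Subgroup.closure_induction with
  | mem w hw =>
    obtain ⟨j, hj, rfl⟩ := hw
    rw [hx j hj, signC_simpleTransp, neg_one_smul]
  | one => rw [leftMul_one, signC_one, one_smul]; rfl
  | mul w z _ _ hw hz => rw [leftMul_mul, hz, map_smul, hw, signC_mul, smul_smul, mul_comm]
  | inv w _ hw =>
    have h : x = signC w • leftMul w⁻¹ x := by
      rw [← map_smul, ← hw, ← leftMul_mul, inv_mul_cancel, leftMul_one]; rfl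
    have : signC w⁻¹ = signC w := by simp [signC]
    rw [this]
    nth_rw 2 [h]
    rw [smul_smul, signC_mul_self, one_smul]

theorem exists_eq_apply_vSet {n : ℕ} {S : Set (Fin (n - 1))} {x : PermSpace n}
    (hx : x ∈ antisymModule S) : ∃ g ∈ HS n, x = g (vSet S) := by
  classical
  have hW : (∑ ν : Equiv.Perm (Fin n), if ν ∈ young S then (1 : ℂ) else 0) ≠ 0 := by
    rw [← sum_filter, sum_const, nsmul_one, Nat.cast_ne_zero, Finset.card_ne_zero]
    exact ⟨1, by simp [one_mem]⟩
  set c := ∑ ν : Equiv.Perm (Fin n), if ν ∈ young S then (1 : ℂ) else 0 with hc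
  set G : Module.End ℂ (PermSpace n) := ∑ μ, (permBasis n).repr x μ • rightMul μ with hG
  -- In the group algebra, `vSet S` times `x` is `x` counted once for each element of the Young
  -- subgroup, whose order is `c`; here `G` is right multiplication by `x`.
  have key : c • x = G (vSet S) := by
    have h1 : c • x = ∑ ν, if ν ∈ young S then signC ν • leftMul ν x else 0 := by
      rw [hc, sum_smul]
      refine sum_congr rfl fun ν _ => ?_
      split_ifs with h
      · rw [leftMul_young hx h, smul_smul, signC_mul_self]
      · rw [zero_smul]
    have h2 : ∀ ν, leftMul ν x = ∑ μ, (permBasis n).repr x μ • permBasis n (ν * μ) := by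
      intro ν
      conv_lhs => rw [← (permBasis n).sum_repr x]
      rw [map_sum]
      simp only [map_smul, leftMul_apply]
    rw [h1, vSet_eq, map_sum]
    refine sum_congr rfl fun ν _ => ?_
    split_ifs
    · rw [map_smul, h2, hG, LinearMap.sum_apply]
      simp only [LinearMap.smul_apply, rightMul_apply]
    · rw [map_zero]
  refine ⟨c⁻¹ • G, (HS n).smul_mem (sum_mem fun μ _ => (HS n).smul_mem (rightMul_mem μ) _) _, ?_⟩
  rw [LinearMap.smul_apply, ← key, smul_smul, inv_mul_cancel₀ hW, one_smul]

/-- Rank one operators with image in `P_S` whose linear form is invariant under the left action of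
the complementary Young subgroup belong to the algebra. -/
theorem smulRight_mem {n : ℕ} {S : Set (Fin (n - 1))} {x : PermSpace n}
    (hx : x ∈ antisymModule S) {φ : PermSpace n →ₗ[ℂ] ℂ}
    (hφ : ∀ i ∈ S, ∀ y, φ (leftMul (simpleTransp i) y) = φ y) : φ.smulRight x ∈ HS n := by
  classical
  have hφ' : ∀ ν ∈ young Sᶜ, ∀ y, φ (leftMul ν y) = φ y := by
    intro ν hν
    unfold young at hν
    induction hν using Subgroup.closure_induction with
    | mem w hw =>
      obtain ⟨j, hj, rfl⟩ := hw
      exact hφ j (by simpa using hj)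
    | one => intro y; rw [leftMul_one]; rfl
    | mul w z _ _ hw hz => intro y; rw [leftMul_mul, hw, hz]
    | inv w _ hw => intro y; rw [← hw, ← leftMul_mul, mul_inv_cancel, leftMul_one]; rfl
  obtain ⟨g, hg, rfl⟩ := exists_eq_apply_vSet hx
  obtain ⟨T, hT, c, hc, hTc⟩ := exists_indicator_op S
  have hW : (∑ ν : Equiv.Perm (Fin n), if ν ∈ young Sᶜ then (1 : ℂ) else 0) ≠ 0 := by
    rw [← sum_filter, sum_const, nsmul_one, Nat.cast_ne_zero, Finset.card_ne_zero]
    exact ⟨1, by simp [one_mem]⟩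
  set d := ∑ ν : Equiv.Perm (Fin n), if ν ∈ young Sᶜ then (1 : ℂ) else 0 with hd
  -- On `μ`, only the `ρ` with `μ * ρ⁻¹` in the Young subgroup of `Sᶜ` contribute. There are `d` of
  -- them, each giving `c • vSet S` with weight `φ ρ = φ μ` by invariance; this accounts for the
  -- factor `(d * c)⁻¹`.
  have e : φ.smulRight (g (vSet S)) =
      g * ((d * c)⁻¹ • ∑ ρ, φ (permBasis n ρ) • (T * rightMul ρ⁻¹)) := by
    refine (permBasis n).ext fun μ => ?_
    rw [LinearMap.smulRight_apply, Module.End.mul_apply, ← map_smul]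
    congr 1
    rw [LinearMap.smul_apply, LinearMap.sum_apply, eq_inv_smul_iff₀ (mul_ne_zero hW hc), hd,
      mul_smul, sum_smul,
      ← Equiv.sum_comp ((Equiv.inv _).trans (Equiv.mulLeft μ)) (fun ν => _ • _)]
    refine sum_congr rfl fun ρ _ => ?_
    rw [LinearMap.smul_apply, Module.End.mul_apply, rightMul_apply, hTc]
    simp only [Equiv.trans_apply, Equiv.inv_apply, Equiv.coe_mulLeft]
    split_ifs with h
    · have := hφ' _ h (permBasis n ρ)
      rw [leftMul_apply, inv_mul_cancel_right] at this
      rw [one_smul, smul_comm, this]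
    · rw [zero_smul, smul_zero]
  rw [e]
  exact mul_mem hg ((HS n).smul_mem
    (sum_mem fun ρ _ => (HS n).smul_mem (mul_mem hT (rightMul_mem _)) _) _)

/-! ### Triangularity and the basis `vPerm` -/

theorem repr_leftMul {n : ℕ} (σ τ : Equiv.Perm (Fin n)) (x : PermSpace n) :
    (permBasis n).repr (leftMul σ x) (σ * τ) = (permBasis n).repr x τ := by
  have : (permBasis n).coord (σ * τ) ∘ₗ leftMul σ = (permBasis n).coord τ := by
    refine (permBasis n).ext fun μ => ?_
    simp [leftMul_apply, Finsupp.single_apply]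
  exact LinearMap.congr_fun this x

theorem smul_mem_antisymModule {n : ℕ} {S : Set (Fin (n - 1))} (c : ℂ) {x : PermSpace n}
    (hx : x ∈ antisymModule S) : c • x ∈ antisymModule S := by
  have h := (antisymModule S).smul_mem (algebraMap ℂ (HS n) c) hx
  rwa [algebraMap_smul] at h

theorem apply_mem_antisymModule {n : ℕ} {S : Set (Fin (n - 1))} {f : Module.End ℂ (PermSpace n)}
    (hf : f ∈ HS n) {x : PermSpace n} (hx : x ∈ antisymModule S) : f x ∈ antisymModule S :=
  (antisymModule S).smul_mem (⟨f, hf⟩ : HS n) hx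

theorem antisymModule_mono {n : ℕ} {S T : Set (Fin (n - 1))} (h : S ⊆ T) :
    antisymModule S ≤ (antisymModule T : Submodule (HS n) (PermSpace n)) :=
  fun _ hx i hi' => hx i fun hS => hi' (h hS)

theorem vPerm_mem {n : ℕ} (σ : Equiv.Perm (Fin n)) : vPerm σ ∈ antisymModule (permRec σ) :=
  apply_mem_antisymModule (rightMul_mem σ) (mem_antisymModule.2 fun _ h => leftMul_vSet h)

theorem repr_vPerm {n : ℕ} {σ τ : Equiv.Perm (Fin n)} (h : energy σ ≤ energy τ) :
    (permBasis n).repr (vPerm σ) τ = if τ = σ then 1 else 0 := by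
  classical
  rw [vPerm, vSet_eq, map_sum, map_sum, Finsupp.finsetSum_apply, Fintype.sum_eq_single 1]
  · rw [if_pos (one_mem _), signC_one, one_smul, rightMul_apply, one_mul, Module.Basis.repr_self,
      Finsupp.single_apply]
    simp only [eq_comm]
  · intro ν hν
    split_ifs with hm
    · rw [map_smul, rightMul_apply, map_smul, Module.Basis.repr_self, Finsupp.smul_apply,
        Finsupp.single_apply, if_neg, smul_zero]
      rintro rfl
      exact absurd (energy_mul_lt hm hν le_rfl) (not_lt.2 h)
    · simp

theorem mem_span_vPerm {n : ℕ} {S : Set (Fin (n - 1))} (N : ℕ) {x : PermSpace n}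
    (hx : x ∈ antisymModule S) (hN : ∀ σ, (permBasis n).repr x σ ≠ 0 → energy σ < N) :
    x ∈ Submodule.span ℂ (vPerm '' {σ | permRec σ ⊆ S}) := by
  classical
  induction N generalizing x with
  | zero =>
    have : x = 0 := by
      rw [← (permBasis n).repr.map_eq_zero_iff]
      ext σ
      by_contra h
      exact absurd (hN σ h) (Nat.not_lt_zero _)
    rw [this]
    exact zero_mem _
  | succ N ih =>
    -- `y` replaces each term of top energy in `x` by the `vPerm σ` it leads, so that `x - y` only
    -- involves smaller energies.
    set y := ∑ σ, if energy σ = N then (permBasis n).repr x σ • vPerm σ else 0 with hy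
    have hrec : ∀ σ, energy σ = N → (permBasis n).repr x σ ≠ 0 → permRec σ ⊆ S := by
      intro σ hσ h0 i hi'
      by_contra hiS
      have e := repr_leftMul (simpleTransp i) σ x
      rw [mem_antisymModule.1 hx i hiS, map_neg, Finsupp.neg_apply] at e
      -- By antisymmetry the coefficients at `σ` and `simpleTransp i * σ` are opposite, hence both
      -- nonzero, yet the latter has energy above the top.
      have := hN (simpleTransp i * σ) fun h => h0 (by rw [← e, h, neg_zero])
      have := energy_lt_simpleTransp_mul hi'
      omega
    have y1 : y ∈ antisymModule S := by
      refine sum_mem fun σ _ => ?_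
      split_ifs with h
      · by_cases h0 : (permBasis n).repr x σ = 0
        · rw [h0, zero_smul]; exact zero_mem _
        · exact smul_mem_antisymModule _ (antisymModule_mono (hrec σ h h0) (vPerm_mem σ))
      · exact zero_mem _
    have y2 : y ∈ Submodule.span ℂ (vPerm '' {σ | permRec σ ⊆ S}) := by
      refine sum_mem fun σ _ => ?_
      split_ifs with h
      · by_cases h0 : (permBasis n).repr x σ = 0
        · rw [h0, zero_smul]; exact zero_mem _
        · exact Submodule.smul_mem _ _ (Submodule.subset_span ⟨σ, hrec σ h h0, rfl⟩)
      · exact zero_mem _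
    rw [← sub_add_cancel x y]
    refine add_mem (ih (sub_mem hx y1) fun τ hτ => ?_) y2
    by_contra hlt
    rw [not_lt] at hlt
    refine hτ ?_
    rw [map_sub, Finsupp.sub_apply, sub_eq_zero, hy, map_sum, Finsupp.finsetSum_apply,
      Fintype.sum_eq_single τ]
    · split_ifs with h
      · rw [map_smul, Finsupp.smul_apply, repr_vPerm le_rfl, if_pos rfl, smul_eq_mul, mul_one]
      · rw [map_zero, Finsupp.zero_apply]
        by_contra h0
        have := hN τ h0
        omega
    · intro σ hσ
      split_ifs with h
      · rw [map_smul, Finsupp.smul_apply, repr_vPerm (h.trans_le hlt), if_neg hσ.symm, smul_zero]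
      · rw [map_zero, Finsupp.zero_apply]

theorem antisymModule_le_span {n : ℕ} {S : Set (Fin (n - 1))} {x : PermSpace n}
    (hx : x ∈ antisymModule S) : x ∈ Submodule.span ℂ (vPerm '' {σ | permRec σ ⊆ S}) :=
  mem_span_vPerm ((∑ σ : Equiv.Perm (Fin n), energy σ) + 1) hx fun σ _ =>
    Nat.lt_succ_of_le (single_le_sum (fun τ _ => Nat.zero_le (energy τ)) (mem_univ σ))

/-- The basis `(v_σ)` of `ℂ𝔖ₙ`. -/
noncomputable def vBasis (n : ℕ) : Module.Basis (Equiv.Perm (Fin n)) ℂ (PermSpace n) :=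
  basisOfTopLeSpanOfCardEqFinrank vPerm
    (fun x _ => by
      -- For `S = univ` no antisymmetry is imposed, so every vector is in the span; independence
      -- follows by counting.
      have := antisymModule_le_span (S := Set.univ) (x := x)
        (mem_antisymModule.2 fun i h => absurd (Set.mem_univ i) h)
      exact Submodule.span_mono (Set.image_subset_range _ _) this)
    (Module.finrank_eq_card_basis (permBasis n)).symm

@[simp] theorem vBasis_apply {n : ℕ} (σ : Equiv.Perm (Fin n)) : vBasis n σ = vPerm σ := by
  simp [vBasis]

theorem mem_antisymModule_iff {n : ℕ} {S : Set (Fin (n - 1))} {x : PermSpace n} :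
    x ∈ antisymModule S ↔ ∀ σ, (vBasis n).repr x σ ≠ 0 → permRec σ ⊆ S := by
  constructor
  · intro hx σ hσ
    have h := antisymModule_le_span hx
    have e : (vPerm : Equiv.Perm (Fin n) → PermSpace n) = vBasis n := funext fun σ => by simp
    rw [e, Module.Basis.mem_span_image] at h
    exact h (by simpa using hσ)
  · intro h
    rw [← (vBasis n).sum_repr x]
    refine sum_mem fun σ _ => ?_
    by_cases h0 : (vBasis n).repr x σ = 0
    · rw [h0, zero_smul]; exact zero_mem _
    · rw [vBasis_apply]
      exact smul_mem_antisymModule _ (antisymModule_mono (h σ h0) (vPerm_mem σ))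

/-! ### The projectors -/

theorem vPerm_ne_zero {n : ℕ} (σ : Equiv.Perm (Fin n)) : vPerm σ ≠ 0 := by
  rw [← vBasis_apply]
  exact (vBasis n).ne_zero σ

theorem lineProjector_apply {n : ℕ} (σ : Equiv.Perm (Fin n)) (x : PermSpace n) :
    lineProjector (vBasis n) σ x = (vBasis n).repr x σ • vPerm σ := by
  rw [lineProjector, LinearMap.smulRight_apply, vBasis_apply, Module.Basis.coord_apply]

theorem lineProjector_mem {n : ℕ} (σ : Equiv.Perm (Fin n)) :
    lineProjector (vBasis n) σ ∈ HS n := by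
  rw [lineProjector, vBasis_apply]
  refine smulRight_mem (vPerm_mem σ) fun i hi' y => ?_
  -- This vector is left `i`-antisymmetric, so it only involves basis vectors without recoil at `i`.
  -- As `σ` has one, its `σ`-coordinate vanishes, which is the required invariance.
  have hy : y - leftMul (simpleTransp i) y ∈ antisymModule ({i}ᶜ : Set (Fin (n - 1))) := by
    refine mem_antisymModule.2 fun j hj => ?_
    obtain rfl : j = i := by simpa using hj
    rw [map_sub, ← leftMul_mul, simpleTransp_mul_self, leftMul_one, Module.End.one_apply, neg_sub]
  by_contra hne
  refine mem_antisymModule_iff.1 hy σ (fun h => hne ?_) hi' rfl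
  rw [map_sub, Finsupp.sub_apply, sub_eq_zero] at h
  exact h.symm

theorem exists_smul_vPerm {n : ℕ} {σ : Equiv.Perm (Fin n)} {x : PermSpace n}
    (hx : x ∈ antisymModule (permRec σ)) : ∃ g : HS n, g • vPerm σ = x := by
  obtain ⟨g, hg, rfl⟩ := exists_eq_apply_vSet hx
  refine ⟨⟨g * rightMul σ⁻¹, mul_mem hg (rightMul_mem _)⟩, ?_⟩
  change g (rightMul σ⁻¹ (rightMul σ (vSet (permRec σ)))) = _
  rw [← Module.End.mul_apply (rightMul _), ← rightMul_mul, mul_inv_cancel, rightMul_one,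
    Module.End.one_apply]

/-- The projector `p_σ` as an element of the algebra. -/
noncomputable def proj {n : ℕ} (σ : Equiv.Perm (Fin n)) : HS n :=
  ⟨lineProjector (vBasis n) σ, lineProjector_mem σ⟩

theorem proj_smul {n : ℕ} (σ : Equiv.Perm (Fin n)) (x : PermSpace n) :
    proj σ • x = (vBasis n).repr x σ • vPerm σ := lineProjector_apply σ x

theorem proj_smul_self {n : ℕ} (σ : Equiv.Perm (Fin n)) : proj σ • vPerm σ = vPerm σ := by
  rw [proj_smul]
  nth_rw 1 [← vBasis_apply]
  rw [Module.Basis.repr_self, Finsupp.single_eq_same, one_smul]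

theorem proj_smul_of_ne {n : ℕ} {σ τ : Equiv.Perm (Fin n)} (h : σ ≠ τ) :
    proj σ • vPerm τ = 0 := by
  rw [proj_smul]
  nth_rw 1 [← vBasis_apply]
  rw [Module.Basis.repr_self, Finsupp.single_eq_of_ne h, zero_smul]

theorem HS_ext {n : ℕ} {f g : HS n} (h : ∀ σ : Equiv.Perm (Fin n), f • vPerm σ = g • vPerm σ) : f = g := by
  refine Subtype.ext ((vBasis n).ext fun σ => ?_)
  rw [vBasis_apply]
  exact h σ

/-- The evaluation at `v_σ`, as a linear map from the algebra to `P_{Rec(σ)}`. -/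
noncomputable def evalMap {n : ℕ} (σ : Equiv.Perm (Fin n)) :
    HS n →ₗ[HS n] antisymModule (permRec σ) :=
  LinearMap.toSpanSingleton (HS n) _ ⟨vPerm σ, vPerm_mem σ⟩

@[simp] theorem coe_evalMap {n : ℕ} (σ : Equiv.Perm (Fin n)) (a : HS n) :
    (evalMap σ a : PermSpace n) = a • vPerm σ := rfl

theorem evalMap_bijective {n : ℕ} (σ : Equiv.Perm (Fin n)) :
    Function.Bijective ((evalMap σ).domRestrict (Ideal.span {proj σ})) := by
  constructor
  · rw [injective_iff_map_eq_zero]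
    rintro ⟨a, ha⟩ h0
    obtain ⟨f, rfl⟩ := Ideal.mem_span_singleton'.1 ha
    refine Subtype.ext (HS_ext fun τ => ?_)
    rw [Submodule.coe_zero, zero_smul]
    by_cases h : σ = τ
    · subst h
      exact congrArg Subtype.val h0
    · rw [mul_smul, proj_smul_of_ne h, smul_zero]
  · rintro ⟨x, hx⟩
    obtain ⟨g, rfl⟩ := exists_smul_vPerm hx
    refine ⟨⟨g * proj σ, Ideal.mem_span_singleton'.2 ⟨g, rfl⟩⟩, Subtype.ext ?_⟩
    rw [LinearMap.domRestrict_apply, coe_evalMap, mul_smul, proj_smul_self]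

/-- The ideal generated by `p_σ` is isomorphic to `P_{Rec(σ)}`. -/
noncomputable def projIdealEquiv {n : ℕ} (σ : Equiv.Perm (Fin n)) :
    Ideal.span {proj σ} ≃ₗ[HS n] antisymModule (permRec σ) :=
  LinearEquiv.ofBijective _ (evalMap_bijective σ)

theorem completeOrthogonalIdempotents_proj (n : ℕ) :
    CompleteOrthogonalIdempotents (proj : Equiv.Perm (Fin n) → HS n) where
  idem σ := HS_ext fun τ => by
    rw [mul_smul]
    by_cases h : σ = τ
    · subst h
      rw [proj_smul_self, proj_smul_self]
    · rw [proj_smul_of_ne h, smul_zero]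
  ortho σ τ hne := HS_ext fun ρ => by
    rw [mul_smul, zero_smul]
    by_cases h : τ = ρ
    · subst h
      rw [proj_smul_self, proj_smul_of_ne hne]
    · rw [proj_smul_of_ne h, smul_zero]
  complete := HS_ext fun τ => by
    rw [sum_smul, one_smul, Fintype.sum_eq_single τ fun σ h => proj_smul_of_ne h, proj_smul_self]

theorem proj_ne_zero {n : ℕ} (σ : Equiv.Perm (Fin n)) : proj σ ≠ 0 := fun h =>
  vPerm_ne_zero σ (by rw [← proj_smul_self, h, zero_smul])

theorem isMaximalDecomposition_proj (n : ℕ) :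
    IsMaximalDecomposition (proj : Equiv.Perm (Fin n) → HS n) where
  complete := completeOrthogonalIdempotents_proj n
  ne_zero := proj_ne_zero
  maximal σ a b ha hb hab hba h := by
    have pa : proj σ * a = a := by rw [h, add_mul, ha.eq, hba, add_zero]
    have ap : a * proj σ = a := by rw [h, mul_add, ha.eq, hab, add_zero]
    have hz : ∀ τ : Equiv.Perm (Fin n), σ ≠ τ → a • vPerm τ = 0 := fun τ hτ => by
      rw [← ap, mul_smul, proj_smul_of_ne hτ, smul_zero]
    -- The summand `a` equals `proj σ * a * proj σ`, so it acts as a scalar on the line of `vPerm σ`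
    -- and as zero on the other basis vectors; idempotence leaves the scalars `0` and `1`.
    have hc : a • vPerm σ = (vBasis n).repr (a • vPerm σ) σ • vPerm σ := by
      rw [← proj_smul, ← mul_smul, pa]
    generalize (vBasis n).repr (a • vPerm σ) σ = c at hc
    have hcc : c * c = c := by
      have h2 : (a * a) • vPerm σ = a • vPerm σ := by rw [ha.eq]
      rw [mul_smul, hc, smul_comm, hc, smul_smul] at h2
      exact smul_left_injective ℂ (vPerm_ne_zero σ) h2
    rcases eq_or_ne c 0 with h0 | h0
    · left
      refine HS_ext fun τ => ?_
      rw [zero_smul]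
      by_cases hτ : σ = τ
      · subst hτ
        rw [hc, h0, zero_smul]
      · exact hz τ hτ
    · right
      have h1 : c = 1 := mul_left_cancel₀ h0 (hcc.trans (mul_one c).symm)
      have : proj σ = a := HS_ext fun τ => by
        by_cases hτ : σ = τ
        · subst hτ
          rw [hc, h1, one_smul, proj_smul_self]
        · rw [hz τ hτ, proj_smul_of_ne hτ]
      rw [this] at h
      exact left_eq_add.1 h

/-! ### Projectivity, indecomposability and pairwise distinctness -/

theorem projective_antisymModule {n : ℕ} (S : Set (Fin (n - 1))) :
    Module.Projective (HS n) (antisymModule S : Submodule (HS n) (PermSpace n)) := by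
  obtain ⟨σ, rfl⟩ := exists_permRec_eq S
  refine Module.Projective.of_split
    ((Ideal.span {proj σ}).subtype ∘ₗ (projIdealEquiv σ).symm.toLinearMap) (evalMap σ)
    (LinearMap.ext fun x => ?_)
  exact (projIdealEquiv σ).apply_symm_apply x

/-- A submodule of `P_S` which involves some `v_σ` with `Rec(σ) = S` is the whole of `P_S`. -/
theorem eq_top_of_repr_ne_zero {n : ℕ} {S : Set (Fin (n - 1))} {σ : Equiv.Perm (Fin n)}
    (hσ : permRec σ = S)
    {N : Submodule (HS n) (antisymModule S : Submodule (HS n) (PermSpace n))}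
    {x : (antisymModule S : Submodule (HS n) (PermSpace n))} (hx : x ∈ N)
    (h : (vBasis n).repr x.val σ ≠ 0) : N = ⊤ := by
  subst hσ
  have hv : (⟨vPerm σ, vPerm_mem σ⟩ : antisymModule (permRec σ)) ∈ N := by
    have := N.smul_mem (algebraMap ℂ (HS n) ((vBasis n).repr x.val σ)⁻¹)
      (N.smul_mem (proj σ) hx)
    convert this
    rw [Submodule.coe_smul, Submodule.coe_smul, proj_smul, algebraMap_smul, smul_smul,
      inv_mul_cancel₀ h, one_smul]
  refine eq_top_iff.2 fun y _ => ?_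
  obtain ⟨g, hg⟩ := exists_smul_vPerm y.2
  have := N.smul_mem g hv
  convert this
  exact Subtype.ext hg.symm

theorem isIndecomposable_antisymModule {n : ℕ} (S : Set (Fin (n - 1))) :
    IsIndecomposable (HS n) (antisymModule S : Submodule (HS n) (PermSpace n)) := by
  obtain ⟨σ, hσ⟩ := exists_permRec_eq S
  have hv : vPerm σ ∈ antisymModule S := hσ ▸ vPerm_mem σ
  refine ⟨⟨⟨vPerm σ, hv⟩, 0, fun h => vPerm_ne_zero σ (congrArg Subtype.val h)⟩,
    fun A B hAB => ?_⟩
  have hmem : (⟨vPerm σ, hv⟩ : (antisymModule S : Submodule (HS n) (PermSpace n))) ∈ A ⊔ B := by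
    rw [hAB.sup_eq_top]
    exact Submodule.mem_top
  obtain ⟨a, ha, b, hb, hab⟩ := Submodule.mem_sup.1 hmem
  have hr : (vBasis n).repr a.val σ + (vBasis n).repr b.val σ = 1 := by
    rw [← Finsupp.add_apply, ← map_add, ← Submodule.coe_add, hab]
    simp only
    rw [← vBasis_apply, Module.Basis.repr_self, Finsupp.single_eq_same]
  by_cases h : (vBasis n).repr a.val σ = 0
  · left
    have hB := eq_top_of_repr_ne_zero hσ hb (by
      rw [h, zero_add] at hr
      rw [hr]
      exact one_ne_zero)
    have := hAB.inf_eq_bot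
    rwa [hB, inf_top_eq] at this
  · right
    have := hAB.inf_eq_bot
    rwa [eq_top_of_repr_ne_zero hσ ha h, top_inf_eq] at this

/-- The image of `vPerm σ` is nonzero and fixed by `proj σ`, so its `σ`-coordinate is nonzero, and
having such a vector in `antisymModule T` forces `permRec σ ⊆ T`. -/
theorem subset_of_antisymModule_equiv {n : ℕ} {S T : Set (Fin (n - 1))}
    (e : (antisymModule S : Submodule (HS n) (PermSpace n)) ≃ₗ[HS n]
      (antisymModule T : Submodule (HS n) (PermSpace n))) : S ⊆ T := by
  obtain ⟨σ, rfl⟩ := exists_permRec_eq S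
  let v : (antisymModule (permRec σ) : Submodule (HS n) (PermSpace n)) := ⟨vPerm σ, vPerm_mem σ⟩
  have h2 : (e v).val = proj σ • (e v).val := by
    refine Eq.trans ?_ (congrArg Subtype.val (e.map_smul (proj σ) v))
    exact congrArg (fun z => (e z).val) (Subtype.ext (proj_smul_self σ).symm)
  refine mem_antisymModule_iff.1 (e v).2 σ fun h0 => ?_
  rw [proj_smul, h0, zero_smul] at h2
  have h3 : e v = 0 := Subtype.ext h2
  exact vPerm_ne_zero σ (congrArg Subtype.val (e.map_eq_zero_iff.1 h3))

/-! ### Classification of the indecomposable projective modules -/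

theorem exists_proj_smul_ne_zero {n : ℕ} {M : Type*} [AddCommGroup M] [Module (HS n) M] {m : M}
    (a : HS n) (ha : a • m ≠ 0) :
    ∃ σ : Equiv.Perm (Fin n), a • proj σ • m ≠ 0 := by
  by_contra! h
  refine ha ?_
  rw [← one_smul (HS n) m, ← (completeOrthogonalIdempotents_proj n).complete, sum_smul, smul_sum]
  exact sum_eq_zero fun σ _ => h σ

theorem injective_of_isIndecomposable {R M N : Type*} [Ring R] [AddCommGroup M] [AddCommGroup N]
    [Module R M] [Module R N] [Module.Projective R N] [Nontrivial N] (hM : IsIndecomposable R M)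
    {f : M →ₗ[R] N} (hsurj : Function.Surjective f) : Function.Injective f := by
  obtain ⟨h, hfh⟩ := Module.projective_lifting_property f LinearMap.id hsurj
  have hfh' : ∀ x, f (h x) = x := LinearMap.congr_fun hfh
  have hcompl : IsCompl (LinearMap.ker f) (LinearMap.range h) := by
    constructor
    · rw [Submodule.disjoint_def]
      rintro _ hx ⟨z, rfl⟩
      rw [LinearMap.mem_ker, hfh'] at hx
      rw [hx, map_zero]
    · rw [codisjoint_iff, eq_top_iff]
      intro x _
      rw [← sub_add_cancel x (h (f x))]
      refine Submodule.add_mem_sup ?_ (LinearMap.mem_range_self h _)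
      rw [LinearMap.mem_ker, map_sub, hfh', sub_self]
  rcases hM.2 _ _ hcompl with h0 | h0
  · exact LinearMap.ker_eq_bot.1 h0
  · obtain ⟨x, hx⟩ := exists_ne (0 : N)
    refine absurd (hfh' x) ?_
    rw [LinearMap.range_eq_bot.1 h0, LinearMap.zero_apply, map_zero]
    exact hx.symm

theorem exists_equiv_antisymModule {n : ℕ} {M : Type*} [AddCommGroup M] [Module (HS n) M]
    (hP : Module.Projective (HS n) M) (hM : IsIndecomposable (HS n) M) :
    ∃ S : Set (Fin (n - 1)),
      Nonempty (M ≃ₗ[HS n] (antisymModule S : Submodule (HS n) (PermSpace n))) := by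
  classical
  have := hM.1
  obtain ⟨s, hs⟩ := Module.projective_def.1 hP
  obtain ⟨m₀, hm₀⟩ := exists_ne (0 : M)
  obtain ⟨σ₀, hσ₀⟩ := exists_proj_smul_ne_zero (1 : HS n) (by rwa [one_smul])
  rw [one_smul] at hσ₀
  -- The largest recoil set is chosen among the projectors acting nontrivially on `M`, so that the
  -- inclusion `hsub` below becomes an equality.
  obtain ⟨σ, hσ, hmax⟩ := exists_max_image
    ({ρ | ∃ m : M, proj ρ • m ≠ 0} : Finset (Equiv.Perm (Fin n))) (fun ρ => (permRec ρ).ncard)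
    ⟨σ₀, by simpa using ⟨m₀, hσ₀⟩⟩
  simp only [mem_filter, mem_univ, true_and] at hσ hmax
  obtain ⟨m', hm'⟩ := hσ
  set m := proj σ • m' with hmdef
  have hpm : proj σ • m = m := by
    rw [hmdef, ← mul_smul, ((completeOrthogonalIdempotents_proj n).idem σ).eq]
  -- `s` embeds `M` in a free module, and `m` is the sum of the `s m y • y`, so some term is
  -- nonzero; its coefficient provides a map from `M` to `HS n`.
  obtain ⟨y, hy⟩ : ∃ y : M, s m y • y ≠ 0 := by
    by_contra! h
    refine hm' ?_
    rw [← hs m, Finsupp.linearCombination_apply]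
    exact sum_eq_zero fun y _ => h y
  set a := s m y with ha
  have hpa : proj σ * a = a := by
    rw [ha, ← smul_eq_mul, ← Finsupp.smul_apply, ← map_smul, hpm]
  obtain ⟨τ, hτ⟩ := exists_proj_smul_ne_zero a hy
  have hav : a • vPerm τ ≠ 0 := by
    intro h0
    refine hτ ?_
    rw [← mul_smul, show a * proj τ = 0 from HS_ext fun ρ => ?_, zero_smul]
    rw [mul_smul, zero_smul]
    by_cases h : τ = ρ
    · subst h
      rw [proj_smul_self, h0]
    · rw [proj_smul_of_ne h, smul_zero]
  have hc : (vBasis n).repr (a • vPerm τ) σ ≠ 0 := by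
    intro h0
    refine hav ?_
    rw [← hpa, mul_smul, proj_smul, h0, zero_smul]
  have hsub : permRec σ ⊆ permRec τ :=
    mem_antisymModule_iff.1 ((antisymModule _).smul_mem a (vPerm_mem τ)) σ hc
  have heq : permRec σ = permRec τ :=
    Set.eq_of_subset_of_ncard_le hsub
      (hmax τ ⟨y, fun h => hτ (by rw [h, smul_zero])⟩) (Set.toFinite _)
  set f : M →ₗ[HS n] antisymModule (permRec τ) := evalMap τ ∘ₗ Finsupp.lapply y ∘ₗ s with hf
  -- `f m = a • vPerm τ` is a nonzero multiple of `vPerm σ`, which generates the target because `σ`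
  -- and `τ` have the same recoils.
  have hsurj : Function.Surjective f := LinearMap.range_eq_top.1
    (eq_top_of_repr_ne_zero heq (x := f m) (LinearMap.mem_range_self f m) hc)
  have := projective_antisymModule (permRec τ)
  have := (isIndecomposable_antisymModule (permRec τ)).1
  have hinj := injective_of_isIndecomposable
    (N := (antisymModule (permRec τ) : Submodule (HS n) (PermSpace n))) hM (f := f) hsurj
  exact ⟨permRec τ, ⟨LinearEquiv.ofBijective f ⟨hinj, hsurj⟩⟩⟩

/-! ### Compositions as subsets -/

theorem mem_compDes_iff {n : ℕ} (I : Composition n) (i : Fin (n - 1)) :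
    i ∈ compDes I ↔ i ∈ compositionAsSetEquiv n (compositionEquiv n I) := by
  have e : i ∈ compositionAsSetEquiv n (compositionEquiv n I) ↔
      (⟨1 + i.val, by omega⟩ : Fin n.succ) ∈ I.boundaries := by
    simp only [compositionAsSetEquiv, Equiv.coe_fn_mk, Set.mem_toFinset, Set.mem_ofPred_eq]
    rfl
  rw [e, Composition.boundaries, Finset.mem_map]
  constructor
  · rintro ⟨j, -, hj, hsum⟩
    refine ⟨⟨j, by omega⟩, Finset.mem_univ _, Fin.ext ?_⟩
    change I.sizeUpTo j = 1 + i.val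
    omega
  · rintro ⟨⟨j, hj⟩, -, h⟩
    have h : I.sizeUpTo j = 1 + i.val := congrArg Fin.val h
    -- The boundary `1 + i` lies strictly between `0` and `n`, which excludes the first and last
    -- partial sums.
    refine ⟨j, Nat.one_le_iff_ne_zero.2 ?_, lt_of_le_of_ne (Nat.lt_succ_iff.1 hj) ?_, by omega⟩
    · rintro rfl
      rw [Composition.sizeUpTo_zero] at h
      omega
    · rintro rfl
      rw [Composition.sizeUpTo_length] at h
      omega

theorem compDes_bijective (n : ℕ) :
    Function.Bijective (compDes : Composition n → Set (Fin (n - 1))) := by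
  classical
  have h : ∀ I : Composition n, compDes I =
      (compositionAsSetEquiv n (compositionEquiv n I) : Set (Fin (n - 1))) :=
    fun I => Set.ext fun i => (mem_compDes_iff I i).trans Finset.mem_coe.symm
  refine ⟨fun I J hIJ => ?_, fun S => ?_⟩
  · rw [h, h, Finset.coe_inj] at hIJ
    exact (compositionEquiv n).injective ((compositionAsSetEquiv n).injective hIJ)
  · refine ⟨(compositionEquiv n).symm ((compositionAsSetEquiv n).symm S.toFinset), ?_⟩
    rw [h, Equiv.apply_symm_apply, Equiv.apply_symm_apply, Set.coe_toFinset]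

end HeckeGroup

theorem theorem3p3 (n : ℕ) :
    -- the vectors `v_σ` form a basis of `ℂ𝔖ₙ`; the projectors `p_σ` are taken with respect to it
    (∃ b : Module.Basis (Equiv.Perm (Fin n)) ℂ (HeckeGroup.PermSpace n),
      (∀ σ, b σ = HeckeGroup.vPerm σ) ∧
      ∃ hp : ∀ σ, HeckeGroup.lineProjector b σ ∈ HeckeGroup.HS n,
        (∀ σ, Nonempty
          (↥(Ideal.span {(⟨HeckeGroup.lineProjector b σ, hp σ⟩ : HeckeGroup.HS n)})
            ≃ₗ[HeckeGroup.HS n] ↥(HeckeGroup.antisymModule (HeckeGroup.permRec σ)))) ∧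
        HeckeGroup.IsMaximalDecomposition
          (fun σ => (⟨HeckeGroup.lineProjector b σ, hp σ⟩ : HeckeGroup.HS n))) ∧
    -- the `P_I` represent the indecomposable projective modules, each exactly once
    (∀ I : Composition n,
      Module.Projective (HeckeGroup.HS n) ↥(HeckeGroup.P I) ∧
      HeckeGroup.IsIndecomposable (HeckeGroup.HS n) ↥(HeckeGroup.P I)) ∧
    (∀ I J : Composition n,
      Nonempty (↥(HeckeGroup.P I) ≃ₗ[HeckeGroup.HS n] ↥(HeckeGroup.P J)) → I = J) ∧
    (∀ (M : Type*) [AddCommGroup M] [Module (HeckeGroup.HS n) M],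
      Module.Projective (HeckeGroup.HS n) M → HeckeGroup.IsIndecomposable (HeckeGroup.HS n) M →
      ∃ I : Composition n, Nonempty (M ≃ₗ[HeckeGroup.HS n] ↥(HeckeGroup.P I))) := by
  open HeckeGroup in
  refine ⟨⟨vBasis n, vBasis_apply, lineProjector_mem, fun σ => ⟨projIdealEquiv σ⟩,
    isMaximalDecomposition_proj n⟩, fun I => ⟨projective_antisymModule _,
    isIndecomposable_antisymModule _⟩, fun I J ⟨e⟩ => ?_, fun M _ _ hP hM => ?_⟩
  · exact (compDes_bijective n).1 (Set.Subset.antisymm (subset_of_antisymModule_equiv e)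
      (subset_of_antisymModule_equiv e.symm))
  · obtain ⟨S, ⟨e⟩⟩ := exists_equiv_antisymModule hP hM
    obtain ⟨I, rfl⟩ := (compDes_bijective n).2 S
    exact ⟨I, ⟨e⟩⟩
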